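/- **Theorem (MLP universal approximation of choice probabilities).** Let $f:\mathbb R^K\to[0,\infty)$ be a probability density with respect to Lebesgue measure which is exchangeable, i.e. $f(P_\pi e)=f(e)$ for every $e\in\mathbb R^K$ and every permutation matrix $P_\pi$. For $v\in\mathbb R^K$ and a symmetric positive semidefinite matrix $\Sigma\in\mathbb R^{K\times K}$ with positive semidefinite square root $\Sigma^{1/2}$, put $$P_j(v,\Sigma)=\int_{\mathcal R_j(v,\Sigma)}f(e)\,de,\qquad \mathcal R_j(v,\Sigma)=\{e\in\mathbb R^K: v_j+(\Sigma^{1/2}e)_j\ge v_k+(\Sigma^{1/2}e)_k\ \text{for all }k\ne j\}.$$ Let $\mathcal X_K$ be the set of pairs $(v,Y)$ with $v\in\mathbb R^K$, $Y\in\mathbb R^{K\times K}$ symmetric, $\sum_i v_i=0$, $Y\mathbf 1=0$ and $\operatorname{tr}Y=K$. Fix $j\in\{1,\dots,K\}$. Let $\mathcal B_j\subset\mathcal X_K$ be the set of $(v,Y)\in\mathcal X_K$ for which at least one of the following fails: (a) the triples $(v_k,Y_{kk},Y_{jk})$, $k\neq j$, are pairwise distinct, and the entries $Y_{kl}$ with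 $k<l$, $k\ne j$, $l\neq j$ are pairwise distinct; (b) for each $k\ne j$ there is exactly one set $S$ of $K-2$ positions $(m,l)$ with $m<l$, $m\neq j$, $l\ne j$ such that $\sum_{(m,l)\in S}Y_{ml}=-Y_{kk}-Y_{jk}$. Let $G_j(v,Y)\in\mathbb R^{3(K-1)+(K-1)(K-2)/2}$ be the vector of sorted components of $g_j(v,Y)$: the triples $(v_k,Y_{kk},Y_{jk})$, $k\ne j$, listed in lexicographic order, followed by the entries $Y_{kl}$ ($k<l$; $k,l\ne j$) listed in increasing order. Let $\sigma:\mathbb R\to\mathbb R$ be a continuous activation function that is not a polynomial. Let $C\subset\mathcal X_K\setminus\mathcal B_j$ be a compact set such that for every $(v,Y)\in C$ the matrix $Y$ is positive semidefinite and there is no $k\neq j$ with both $v_k=v_j$ and $Y_{jj}+Y_{kk}-2Y_{jk}=0$ (that is, no other alternative has the same random utility as $j$). Then for every $\varepsilon>0$ there is a multi-layer perceptron $N$ with activation $\sigma$, at least one hidden layer and an affine output layer such that $$\sup_{(v,Y)\in C}\bigl|N(G_j(v,Y))-P_j(v,Y)\bigr|\le\varepsilon.$$ -/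

import Mathlib

open MeasureTheory

namespace DiscreteChoice

noncomputable section

/-- Assumption on the base error vector: `f` is a probability density with respect to Lebesgue
measure on `ℝ^K`, invariant under every permutation of the coordinates. -/
structure IsExchangeableDensity {K : ℕ} (f : (Fin K → ℝ) → ℝ) : Prop where
  measurable : Measurable f
  nonneg : ∀ e, 0 ≤ f e
  lintegral_eq_one : ∫⁻ e, ENNReal.ofReal (f e) = 1
  exchangeable : ∀ (π : Equiv.Perm (Fin K)) (e : Fin K → ℝ), f (e ∘ π) = f e

/-- The (symmetric, positive semidefinite) square root `Σ^{1/2}` of a positive semidefinite real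
matrix. -/
def sqrtMatrix {K : ℕ} (S : Matrix (Fin K) (Fin K) ℝ) : Matrix (Fin K) (Fin K) ℝ :=
  open scoped MatrixOrder in CFC.sqrt S

/-- The utility `U_k = v_k + [Σ^{1/2} ε]_k` of alternative `k` for the base error `e`. -/
def utility {K : ℕ} (v : Fin K → ℝ) (S : Matrix (Fin K) (Fin K) ℝ) (e : Fin K → ℝ) (k : Fin K) :
    ℝ :=
  v k + (sqrtMatrix S).mulVec e k

/-- The region of the error space in which alternative `j` is chosen. -/
def choiceRegion {K : ℕ} (j : Fin K) (v : Fin K → ℝ) (S : Matrix (Fin K) (Fin K) ℝ) :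
    Set (Fin K → ℝ) :=
  {e | ∀ k, k ≠ j → utility v S e k ≤ utility v S e j}

/-- The choice probability `P_j(v, Σ)`. -/
def choiceProb {K : ℕ} (f : (Fin K → ℝ) → ℝ) (j : Fin K) (v : Fin K → ℝ)
    (S : Matrix (Fin K) (Fin K) ℝ) : ℝ :=
  ∫ e in choiceRegion j v S, f e

/-- The centered, trace-normalized utility-covariance space `𝒳_K`. -/
def centeredSpace (K : ℕ) : Set ((Fin K → ℝ) × Matrix (Fin K) (Fin K) ℝ) :=
  {x | x.2.IsSymm ∧ ∑ i, x.1 i = 0 ∧ x.2.mulVec (fun _ => 1) = 0 ∧ x.2.trace = K}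

/-- The alternatives other than `j`. -/
def others {K : ℕ} (j : Fin K) : Finset (Fin K) :=
  Finset.univ.filter fun k => k ≠ j

/-- The off-diagonal positions `(k, l)`, `k < l`, of the submatrix with row and column `j`
removed. -/
def offPositions {K : ℕ} (j : Fin K) : Finset (Fin K × Fin K) :=
  Finset.univ.filter fun p => p.1 < p.2 ∧ p.1 ≠ j ∧ p.2 ≠ j

/-- The triple `(v_k, Y_kk, Y_jk)`, with the lexicographic order on triples. -/
def triple {K : ℕ} (j : Fin K) (x : (Fin K → ℝ) × Matrix (Fin K) (Fin K) ℝ) (k : Fin K) :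
    ℝ ×ₗ ℝ ×ₗ ℝ :=
  toLex (x.1 k, toLex (x.2 k k, x.2 j k))

/-- The multiset `𝒯_j` of triples. -/
def tripleMultiset {K : ℕ} (j : Fin K) (x : (Fin K → ℝ) × Matrix (Fin K) (Fin K) ℝ) :
    Multiset (ℝ ×ₗ ℝ ×ₗ ℝ) :=
  (others j).val.map (triple j x)

/-- The multiset `𝒪_j` of off-diagonal entries away from `j`. -/
def offMultiset {K : ℕ} (j : Fin K) (x : (Fin K → ℝ) × Matrix (Fin K) (Fin K) ℝ) :
    Multiset ℝ :=
  (offPositions j).val.map fun p => x.2 p.1 p.2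

/-- The exceptional set `ℬ_j`: the points of `𝒳_K` at which one of the genericity conditions
fails. -/
def exceptionalSet {K : ℕ} (j : Fin K) : Set ((Fin K → ℝ) × Matrix (Fin K) (Fin K) ℝ) :=
  {x | x ∈ centeredSpace K ∧
    ¬ ((Set.InjOn (triple j x) (others j) ∧
        Set.InjOn (fun p : Fin K × Fin K => x.2 p.1 p.2) (offPositions j)) ∧
      ∀ k, k ≠ j → ∃! T : Finset (Fin K × Fin K),
        T ⊆ offPositions j ∧ T.card = K - 2 ∧ ∑ p ∈ T, x.2 p.1 p.2 = -x.2 k k - x.2 j k)}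

/-- The points at which `P_j` is a choice probability without structural ties: the scale matrix
has a square root, and no other alternative `k` has `v_k = v_j` together with
`Σ_jj + Σ_kk - 2 Σ_jk = 0` (which would make `U_k` and `U_j` identical). -/
def choiceDomain {K : ℕ} (j : Fin K) : Set ((Fin K → ℝ) × Matrix (Fin K) (Fin K) ℝ) :=
  {x | x.2.PosSemidef ∧
    ∀ k, k ≠ j → ¬ (x.1 k = x.1 j ∧ x.2 j j + x.2 k k - 2 * x.2 j k = 0)}

/-- Labels of the real components of `g_j`: three for each of the `K - 1` triples, and one for each
of the `(K - 1)(K - 2) / 2` off-diagonal entries. -/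
abbrev FeatureIndex {K : ℕ} (j : Fin K) : Type :=
  (Fin (others j).card × Fin 3) ⊕ Fin (offPositions j).card

/-- The `i`-th triple of `𝒯_j` in lexicographic order. -/
def sortedTriple {K : ℕ} (j : Fin K) (x : (Fin K → ℝ) × Matrix (Fin K) (Fin K) ℝ)
    (i : Fin (others j).card) : ℝ ×ₗ ℝ ×ₗ ℝ :=
  ((tripleMultiset j x).sort (· ≤ ·))[i.1]'(by simp [tripleMultiset])

/-- The `i`-th entry of `𝒪_j` in increasing order. -/
def sortedOff {K : ℕ} (j : Fin K) (x : (Fin K → ℝ) × Matrix (Fin K) (Fin K) ℝ)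
    (i : Fin (offPositions j).card) : ℝ :=
  ((offMultiset j x).sort (· ≤ ·))[i.1]'(by simp [offMultiset])

/-- The sorted components of `g_j`, as a real vector. -/
def features {K : ℕ} (j : Fin K) (x : (Fin K → ℝ) × Matrix (Fin K) (Fin K) ℝ) :
    FeatureIndex j → ℝ
  | Sum.inl (i, c) =>
      ![(ofLex (sortedTriple j x i)).1, (ofLex (ofLex (sortedTriple j x i)).2).1,
        (ofLex (ofLex (sortedTriple j x i)).2).2] c
  | Sum.inr i => sortedOff j x i

/-- Multi-layer perceptrons (weights and biases) with inputs indexed by `ι`, one real output, and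
at least one hidden layer. -/
inductive MLP : Type → Type 1
  | shallow {ι : Type} {h : ℕ} (W : Matrix (Fin h) ι ℝ) (b : Fin h → ℝ) (a : Fin h → ℝ) (c : ℝ) :
      MLP ι
  | deep {ι : Type} {h : ℕ} (W : Matrix (Fin h) ι ℝ) (b : Fin h → ℝ) (N : MLP (Fin h)) : MLP ι

/-- The function computed by a perceptron with activation `σ`: each hidden layer is
`z ↦ σ(W z + b)`, with `σ` applied coordinatewise, and the output layer is affine. -/
def MLP.eval (σ : ℝ → ℝ) : {ι : Type} → [Fintype ι] → MLP ι → (ι → ℝ) → ℝ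
  | _, _, .shallow W b a c, z => ∑ i, a i * σ (W.mulVec z i + b i) + c
  | _, _, .deep W b N, z => N.eval σ fun i => σ (W.mulVec z i + b i)

end

end DiscreteChoice

/-! Three facts combine. `P_j` is continuous where no structural tie occurs, since non-structural
ties are null (`continuousOn_choiceProb`). By exchangeability it is invariant under relabelling the
other alternatives (`choiceProb_submatrix`). Off the exceptional set, the feature multisets
determine the point up to such a relabelling (`exists_perm_of_multisets_eq`): zero row sums make the
positions involving `k` a set with the prescribed sum, and uniqueness of that set tells which
entries belong to `k`.

Lexicographic sorting need not be continuous, so the features are taken along all enumerations at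
once. This gives a continuous map on a compact space, and `P_j` is constant on its fibers, hence a
continuous function on its compact image (`exists_continuous_factor`). The sorted features lie in
that image.

One hidden layer then suffices by `exists_shallow_approx`, proved by duality: a functional killing
every ridge function of `σ` kills all powers of linear forms, hence their exponentials, hence
everything by Stone–Weierstrass. -/

namespace DiscreteChoice

/-! ### Universal approximation with one hidden layer -/

open scoped Topology Convolution ContDiff

/-- A smooth function whose `n`-th derivative vanishes identically is a polynomial of degree less
than `n`. -/
theorem exists_polynomial_of_iteratedDeriv_eq_zero (n : ℕ) :
    ∀ g : ℝ → ℝ, ContDiff ℝ ∞ g → (∀ t, iteratedDeriv n g t = 0) →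
      ∃ p : Polynomial ℝ, p.degree < n ∧ ∀ t, g t = p.eval t := by
  intro g hg h
  -- Taylor polynomial at 0; its derivative is the Taylor polynomial of `deriv g`, which drives the
  -- induction.
  refine ⟨∑ k ∈ Finset.range n, Polynomial.C (iteratedDeriv k g 0 / k.factorial) *
    Polynomial.X ^ k, ?_, ?_⟩
  · exact Polynomial.degree_sum_fin_lt _ |>.trans_eq' (by
      rw [Finset.sum_range])
  · induction n generalizing g with
    | zero => intro t; simpa using h t
    | succ n ih =>
      have hd : ContDiff ℝ ∞ (deriv g) := (contDiff_infty_iff_deriv.1 hg).2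
      have hd' := ih (deriv g) hd (fun t => by rw [← h t, iteratedDeriv_succ'])
      set p : Polynomial ℝ := ∑ k ∈ Finset.range (n + 1),
        Polynomial.C (iteratedDeriv k g 0 / k.factorial) * Polynomial.X ^ k with hp
      have hder : Polynomial.derivative p = ∑ k ∈ Finset.range n,
          Polynomial.C (iteratedDeriv k (deriv g) 0 / k.factorial) * Polynomial.X ^ k := by
        rw [hp, Finset.sum_range_succ', Polynomial.derivative_add, Polynomial.derivative_sum]
        simp only [Polynomial.derivative_C_mul_X_pow, pow_zero, mul_one, Polynomial.derivative_C,
          add_zero, Nat.add_sub_cancel]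
        refine Finset.sum_congr rfl fun k _ => ?_
        rw [iteratedDeriv_succ', Nat.factorial_succ]
        congr 2
        push_cast
        have : (k.factorial : ℝ) ≠ 0 := by positivity
        have : (k + 1 : ℝ) ≠ 0 := by positivity
        field_simp
      have hdiff : Differentiable ℝ g := hg.differentiable (by simp)
      have hconst := is_const_of_deriv_eq_zero (f := fun t => g t - p.eval t)
        (hdiff.sub p.differentiable) (fun t => by
          rw [deriv_fun_sub (hdiff t) p.differentiableAt, Polynomial.deriv, hder, hd' t, sub_self])
      intro t
      have h0 := hconst t 0
      have hp0 : p.eval 0 = g 0 := by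
        rw [hp, Polynomial.eval_finsetSum, Finset.sum_range_succ']
        simp
      simp only [hp0, sub_self] at h0
      linarith

/-- A pointwise limit of polynomial functions of bounded degree is a polynomial function. -/
theorem exists_polynomial_of_tendsto (n : ℕ) (g : ℝ → ℝ) (p : ℕ → Polynomial ℝ)
    (hdeg : ∀ i, (p i).degree < n)
    (hlim : ∀ t, Filter.Tendsto (fun i => (p i).eval t) Filter.atTop (𝓝 (g t))) :
    ∃ q : Polynomial ℝ, ∀ t, g t = q.eval t := by
  have hinj : Set.InjOn (fun i : ℕ => (i : ℝ)) (Finset.range n) := Nat.cast_injective.injOn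
  -- Degree below `n` means each `p i` is recovered from its values at `0, …, n - 1`, and these
  -- finitely many values converge.
  refine ⟨Lagrange.interpolate (Finset.range n) (fun i : ℕ => (i : ℝ)) (fun i => g i), fun t => ?_⟩
  refine tendsto_nhds_unique (hlim t) ?_
  have hp : ∀ i, (p i).eval t = ∑ k ∈ Finset.range n,
      (p i).eval (k : ℝ) * (Lagrange.basis (Finset.range n) (fun i : ℕ => (i : ℝ)) k).eval t := by
    intro i
    conv_lhs => rw [Lagrange.eq_interpolate (f := p i) hinj (by simpa using hdeg i)]
    simp [Lagrange.interpolate_apply, Polynomial.eval_finsetSum]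
  simp only [hp, Lagrange.interpolate_apply, Polynomial.eval_finsetSum, Polynomial.eval_mul,
    Polynomial.eval_C]
  exact tendsto_finsetSum _ fun k _ => (hlim k).mul_const _

theorem continuous_iteratedDeriv_of_smooth {g : ℝ → ℝ} (hg : ContDiff ℝ ∞ g) (n : ℕ) :
    Continuous (iteratedDeriv n g) :=
  hg.continuous_iteratedDeriv n (by exact_mod_cast le_top)

variable {X : Type*} [TopologicalSpace X]

/-- The function `x ↦ g (t * u x + b)` on `X`. -/
def ridge (u : C(X, ℝ)) (g : ℝ → ℝ) (hg : Continuous g) (t b : ℝ) : C(X, ℝ) :=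
  ⟨fun x => g (t * u x + b), by fun_prop⟩

variable [CompactSpace X]

/-- A functional annihilating `x ↦ g (t * u x + b)` for all `t`, `b` annihilates the same functions
for a mollification of `g`. -/
theorem map_ridge_convolution_eq_zero (L : C(X, ℝ) →L[ℝ] ℝ) (u : C(X, ℝ)) (g : ℝ → ℝ)
    (hg : Continuous g) (hL : ∀ t b, L (ridge u g hg t b) = 0) (φ : ℝ → ℝ) (hφ : Continuous φ)
    (hφc : HasCompactSupport φ)
    (hc : Continuous (φ ⋆[ContinuousLinearMap.lsmul ℝ ℝ, volume] g)) (t b : ℝ) :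
    L (ridge u (φ ⋆[ContinuousLinearMap.lsmul ℝ ℝ, volume] g) hc t b) = 0 := by
  have hcont : Continuous fun s : ℝ => φ s • ridge u g hg t (b - s) := by
    refine ContinuousMap.continuous_of_continuous_uncurry _ ?_
    simp only [ridge, ContinuousMap.coe_smul, ContinuousMap.coe_mk, Pi.smul_apply]
    fun_prop
  have hint : Integrable fun s : ℝ => φ s • ridge u g hg t (b - s) :=
    hcont.integrable_of_hasCompactSupport hφc.smul_right
  -- The convolution is a Bochner integral in `C(X, ℝ)` of ridge functions with shifted bias, so `L`
  -- passes under it.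
  have heq : ridge u (φ ⋆[ContinuousLinearMap.lsmul ℝ ℝ, volume] g) hc t b
      = ∫ s, φ s • ridge u g hg t (b - s) := by
    ext x
    rw [← ContinuousMap.evalCLM_apply ℝ x (∫ s, _),
      ← ContinuousLinearMap.integral_comp_comm _ hint]
    simp [ridge, convolution_def, add_sub_assoc]
  rw [heq, ← L.integral_comp_comm hint]
  simp [hL]

/-- A functional annihilating `x ↦ g (t * u x + b)` for all `t`, `b` annihilates their derivatives
in `t`. -/
theorem map_pow_mul_ridge_iteratedDeriv_eq_zero (L : C(X, ℝ) →L[ℝ] ℝ) (u : C(X, ℝ)) (g : ℝ → ℝ)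
    (hg : ContDiff ℝ ∞ g) (hL : ∀ t b, L (ridge u g hg.continuous t b) = 0) (n : ℕ) (t b : ℝ) :
    L (u ^ n * ridge u (iteratedDeriv n g) (continuous_iteratedDeriv_of_smooth hg n) t b) = 0 := by
  induction n generalizing t with
  | zero => simpa [iteratedDeriv_zero] using hL t b
  | succ n ih =>
    set F : ℝ → C(X, ℝ) := fun s => u ^ (n + 1) *
      ridge u (iteratedDeriv (n + 1) g) (continuous_iteratedDeriv_of_smooth hg (n + 1)) s b with hF
    have hc1 : Continuous (iteratedDeriv (n + 1) g) :=
      continuous_iteratedDeriv_of_smooth hg (n + 1)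
    have hcont : Continuous F := by
      refine ContinuousMap.continuous_of_continuous_uncurry _ ?_
      simp only [hF, ridge, ContinuousMap.coe_mul, ContinuousMap.coe_mk, Pi.mul_apply,
        ContinuousMap.coe_pow, Pi.pow_apply]
      fun_prop
    -- Instead of differentiating in the sup norm, integrate the derivative: the integral is a
    -- difference of two functions killed by `L`. Differentiating in the endpoint then gives `L (F
    -- t) = 0`.
    have hzero : ∀ r : ℝ, ∫ s in (0 : ℝ)..r, L (F s) = 0 := by
      intro r
      rw [L.intervalIntegral_comp_comm (hcont.intervalIntegrable _ _)]
      have heq : ∫ s in (0 : ℝ)..r, F s =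
          u ^ n * ridge u (iteratedDeriv n g) (continuous_iteratedDeriv_of_smooth hg n) r b -
          u ^ n * ridge u (iteratedDeriv n g) (continuous_iteratedDeriv_of_smooth hg n) 0 b := by
        ext x
        rw [← ContinuousMap.evalCLM_apply ℝ x (∫ s in (0 : ℝ)..r, F s),
          ← ContinuousLinearMap.intervalIntegral_comp_comm _ (hcont.intervalIntegrable _ _)]
        rw [intervalIntegral.integral_eq_sub_of_hasDerivAt
          (f := fun s => u x ^ n * iteratedDeriv n g (s * u x + b))]
        · simp [ridge]
        · intro s _
          have hd : HasDerivAt (iteratedDeriv n g) (iteratedDeriv (n + 1) g (s * u x + b))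
              (s * u x + b) := by
            rw [iteratedDeriv_succ]
            exact ((hg.differentiable_iteratedDeriv n (by
              exact_mod_cast WithTop.coe_lt_top _)) _).hasDerivAt
          have hi : HasDerivAt (fun s => s * u x + b) (u x) s := by
            simpa using ((hasDerivAt_id s).mul_const (u x)).add_const b
          refine ((hd.comp s hi).const_mul (u x ^ n)).congr_deriv ?_
          simp only [hF, ridge, ContinuousMap.evalCLM_apply, ContinuousMap.mul_apply,
            ContinuousMap.pow_apply, ContinuousMap.coe_mk]
          ring
        · exact ((ContinuousMap.evalCLM ℝ x).continuous.comp hcont).intervalIntegrable _ _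
      rw [heq, map_sub, ih, ih, sub_zero]
    have hLF : Continuous fun s => L (F s) := L.continuous.comp hcont
    have h1 := (hLF.integral_hasStrictDerivAt 0 t).hasDerivAt
    have h2 : (fun r => ∫ s in (0 : ℝ)..r, L (F s)) = fun _ => 0 := funext hzero
    rw [h2] at h1
    exact h1.unique (hasDerivAt_const t 0)

/-- A functional annihilating `x ↦ σ (t * u x + b)` for all `t`, `b`, with `σ` continuous and not
a polynomial, annihilates all powers of `u`. -/
theorem map_pow_eq_zero_of_map_ridge (σ : ℝ → ℝ) (hσ : Continuous σ)
    (hσp : ¬ ∃ p : Polynomial ℝ, ∀ t, σ t = p.eval t) (L : C(X, ℝ) →L[ℝ] ℝ) (u : C(X, ℝ))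
    (hL : ∀ t b, L (ridge u σ hσ t b) = 0) (n : ℕ) : L (u ^ n) = 0 := by
  by_contra hne
  apply hσp
  let φ : ℕ → ContDiffBump (0 : ℝ) := fun i =>
    ⟨1 / (2 * (i + 1)), 1 / (i + 1), by positivity, by
      apply one_div_lt_one_div_of_lt <;> [positivity; linarith [Nat.cast_nonneg (α := ℝ) i]]⟩
  let ψ : ℕ → ℝ → ℝ := fun i =>
    ((φ i).normed volume ⋆[ContinuousLinearMap.lsmul ℝ ℝ, volume] σ)
  have hψ : ∀ i, ContDiff ℝ ∞ (ψ i) := fun i =>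
    (φ i).hasCompactSupport_normed.contDiff_convolution_left _ (φ i).contDiff_normed
      hσ.locallyIntegrable
  have hpoly : ∀ i, ∃ p : Polynomial ℝ, p.degree < n ∧ ∀ t, ψ i t = p.eval t := by
    intro i
    refine exists_polynomial_of_iteratedDeriv_eq_zero n _ (hψ i) fun b => ?_
    -- At `t = 0` the ridge factor is the constant `iteratedDeriv n (ψ i) b`; since `L (u ^ n) ≠ 0`,
    -- it must vanish for every `b`.
    have h := map_pow_mul_ridge_iteratedDeriv_eq_zero L u (ψ i) (hψ i)
      (fun t b => map_ridge_convolution_eq_zero L u σ hσ hL _ (φ i).continuous_normed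
        (φ i).hasCompactSupport_normed (hψ i).continuous t b) n 0 b
    have heq : u ^ n * ridge u (iteratedDeriv n (ψ i))
        (continuous_iteratedDeriv_of_smooth (hψ i) n) 0 b = iteratedDeriv n (ψ i) b • u ^ n := by
      ext x
      simp [ridge, mul_comm]
    rw [heq, map_smul, smul_eq_mul] at h
    exact (mul_eq_zero.1 h).resolve_right hne
  choose p hdeg hp using hpoly
  refine exists_polynomial_of_tendsto n σ p hdeg fun t => ?_
  simp only [← hp]
  exact ContDiffBump.convolution_tendsto_right_of_continuous
    (tendsto_one_div_add_atTop_nhds_zero_nat) hσ t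

/-- The linear form `x ↦ ∑ i, w i * z x i`. -/
def linearForm {ι : Type*} [Fintype ι] (z : C(X, ι → ℝ)) (w : ι → ℝ) : C(X, ℝ) :=
  ⟨fun x => ∑ i, w i * z x i, by fun_prop⟩

/-- The exponential of a continuous function. -/
noncomputable def expComp (u : C(X, ℝ)) : C(X, ℝ) := ⟨fun x => Real.exp (u x), by fun_prop⟩

/-- The exponential series converges in the Banach algebra `C(X, ℝ)`, so `L` applies term by term.
-/
theorem map_expComp_eq_zero (L : C(X, ℝ) →L[ℝ] ℝ) (u : C(X, ℝ)) (hL : ∀ n, L (u ^ n) = 0) :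
    L (expComp u) = 0 := by
  have hs : HasSum (fun n : ℕ => ((n.factorial : ℝ)⁻¹) • u ^ n) (NormedSpace.exp u) :=
    NormedSpace.exp_series_hasSum_exp' (𝕂 := ℝ) u
  have hexp : NormedSpace.exp u = expComp u := by
    ext x
    have h := hs.mapL (ContinuousMap.evalCLM ℝ x)
    have h' := NormedSpace.exp_series_hasSum_exp' (𝕂 := ℝ) (u x)
    rw [← Real.exp_eq_exp_ℝ] at h'
    refine h.unique ?_
    simpa [expComp] using h'
  have h := hs.mapL L
  rw [hexp] at h
  refine h.unique ?_
  simp [hL]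

/-- Density of the exponentials of linear forms. -/
theorem eq_zero_of_map_expComp {ι : Type*} [Fintype ι] (z : C(X, ι → ℝ))
    (hz : Function.Injective z) (L : C(X, ℝ) →L[ℝ] ℝ)
    (hL : ∀ w, L (expComp (linearForm z w)) = 0) : L = 0 := by
  -- Closure under products makes the generated algebra equal to the linear span, on which `L`
  -- vanishes.
  let M : Submonoid C(X, ℝ) :=
    { carrier := Set.range fun w => expComp (linearForm z w)
      one_mem' := ⟨0, by ext x; simp [expComp, linearForm]⟩
      mul_mem' := by
        rintro _ _ ⟨w, rfl⟩ ⟨w', rfl⟩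
        refine ⟨w + w', ?_⟩
        ext x
        simp [expComp, linearForm, add_mul, Finset.sum_add_distrib, Real.exp_add] }
  let A : Subalgebra ℝ C(X, ℝ) := Algebra.adjoin ℝ (M : Set C(X, ℝ))
  have hsep : A.SeparatesPoints := by
    intro x y hxy
    have hne : z x ≠ z y := fun h => hxy (hz h)
    obtain ⟨i, hi⟩ := Function.ne_iff.1 hne
    classical
    refine ⟨_, ⟨expComp (linearForm z (Pi.single i 1)),
      Algebra.subset_adjoin ⟨_, rfl⟩, rfl⟩, ?_⟩
    simpa [expComp, linearForm, Pi.single_apply] using hi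
  have hA := ContinuousMap.subalgebra_topologicalClosure_eq_top_of_separatesPoints A hsep
  have hLA : ∀ a ∈ A, L a = 0 := by
    intro a ha
    have ha' : a ∈ Subalgebra.toSubmodule A := ha
    rw [Algebra.adjoin_eq_span, Submonoid.closure_eq] at ha'
    have hle : Submodule.span ℝ (M : Set C(X, ℝ)) ≤ L.ker :=
      Submodule.span_le.2 (by rintro _ ⟨w, rfl⟩; exact hL w)
    exact hle ha'
  ext a
  have ha : a ∈ closure (A : Set C(X, ℝ)) := by
    have : a ∈ A.topologicalClosure := by rw [hA]; trivial
    exact this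
  have hcl : IsClosed {a : C(X, ℝ) | L a = 0} := isClosed_eq L.continuous continuous_const
  exact (closure_minimal (fun a ha => hLA a ha) hcl) ha

/-- **Universal approximation** (Leshno, Lin, Pinkus, Schocken) for a continuous activation: the
functions computed by perceptrons with one hidden layer are dense in the continuous functions on
a compact space that embeds into a finite-dimensional space. -/
theorem exists_shallow_approx {ι : Type} [Fintype ι] (z : C(X, ι → ℝ))
    (hz : Function.Injective z) (σ : ℝ → ℝ) (hσ : Continuous σ)
    (hσp : ¬ ∃ p : Polynomial ℝ, ∀ t, σ t = p.eval t) (Φ : C(X, ℝ)) (ε : ℝ) (hε : 0 < ε) :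
    ∃ N : MLP ι, ∀ x, |N.eval σ (z x) - Φ x| < ε := by
  let unit : (ι → ℝ) × ℝ → C(X, ℝ) := fun q => ridge (linearForm z q.1) σ hσ 1 q.2
  let V : Submodule ℝ C(X, ℝ) := Submodule.span ℝ (Set.range unit)
  have hV : Φ ∈ closure (V : Set C(X, ℝ)) := by
    by_contra hΦ
    obtain ⟨L, c, hLV, hc⟩ := geometric_hahn_banach_closed_point
      (V.convex.closure) isClosed_closure hΦ
    have hL0 : ∀ a ∈ V, L a = 0 := by
      intro a ha
      by_contra hne
      -- A nonzero value could be rescaled to the bound `c` itself, contradicting strict separation.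
      have h := hLV ((c / L a) • a) (subset_closure (V.smul_mem _ ha))
      rw [map_smul, smul_eq_mul, div_mul_cancel₀ _ hne] at h
      exact lt_irrefl _ h
    have hLz : L = 0 := by
      refine eq_zero_of_map_expComp z hz L fun w => ?_
      refine map_expComp_eq_zero L _ fun n => ?_
      refine map_pow_eq_zero_of_map_ridge σ hσ hσp L _ (fun t b => ?_) n
      refine hL0 _ (Submodule.subset_span ⟨(t • w, b), ?_⟩)
      ext x
      simp [unit, ridge, linearForm, Finset.mul_sum, mul_assoc]
    have h0 := hLV 0 (subset_closure V.zero_mem)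
    rw [hLz] at h0 hc
    simp at h0 hc
    linarith
  obtain ⟨a, ha, hdist⟩ := Metric.mem_closure_iff.1 hV ε hε
  obtain ⟨l, rfl⟩ := (Finsupp.mem_span_range_iff_exists_finsupp).1 ha
  let e := l.support.equivFin
  refine ⟨.shallow (h := l.support.card) (fun i k => (e.symm i).1.1 k) (fun i => (e.symm i).1.2)
    (fun i => l (e.symm i).1) 0, fun x => ?_⟩
  have hx := (ContinuousMap.dist_lt_iff hε).1 hdist x
  rw [Real.dist_eq, abs_sub_comm] at hx
  convert hx using 3
  rw [Finsupp.sum, ContinuousMap.coe_sum, Finset.sum_apply,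
    ← Finset.sum_coe_sort l.support, ← e.symm.sum_comp]
  simp [MLP.eval, unit, ridge, linearForm, Matrix.mulVec, dotProduct]

end DiscreteChoice

/-! ### Invariance and continuity of the choice probability -/

namespace DiscreteChoice

open scoped Topology

variable {K : ℕ}

section Sqrt

open scoped MatrixOrder Matrix.Norms.L2Operator

theorem continuousOn_sqrtMatrix :
    ContinuousOn (sqrtMatrix : Matrix (Fin K) (Fin K) ℝ → Matrix (Fin K) (Fin K) ℝ)
      {S | S.PosSemidef} := by
  have h : ContinuousOn (CFC.sqrt : Matrix (Fin K) (Fin K) ℝ → _) {a | 0 ≤ a} :=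
    CFC.continuousOn_sqrt
  exact h.mono fun S hS => hS.nonneg

theorem sqrtMatrix_mul_self {S : Matrix (Fin K) (Fin K) ℝ} (hS : S.PosSemidef) :
    sqrtMatrix S * sqrtMatrix S = S :=
  CFC.sqrt_mul_sqrt_self S hS.nonneg

theorem sqrtMatrix_posSemidef (S : Matrix (Fin K) (Fin K) ℝ) : (sqrtMatrix S).PosSemidef :=
  Matrix.nonneg_iff_posSemidef.1 (CFC.sqrt_nonneg S)

theorem sqrtMatrix_eq_of_mul_self {S A : Matrix (Fin K) (Fin K) ℝ} (h : A * A = S)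
    (hA : A.PosSemidef) : sqrtMatrix S = A :=
  CFC.sqrt_unique h hA.nonneg

end Sqrt

/-- Uniqueness of the positive semidefinite root: the relabelled root squares to the relabelled
matrix. -/
theorem sqrtMatrix_submatrix {S : Matrix (Fin K) (Fin K) ℝ} (hS : S.PosSemidef)
    (π : Equiv.Perm (Fin K)) :
    sqrtMatrix (S.submatrix π π) = (sqrtMatrix S).submatrix π π := by
  refine sqrtMatrix_eq_of_mul_self ?_ ((sqrtMatrix_posSemidef S).submatrix π)
  rw [Matrix.submatrix_mul_equiv, sqrtMatrix_mul_self hS]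

theorem utility_submatrix {S : Matrix (Fin K) (Fin K) ℝ} (hS : S.PosSemidef)
    (π : Equiv.Perm (Fin K)) (v e : Fin K → ℝ) (k : Fin K) :
    utility (v ∘ π) (S.submatrix π π) (e ∘ π) k = utility v S e (π k) := by
  simp only [utility, sqrtMatrix_submatrix hS, Function.comp_apply, Matrix.mulVec, dotProduct,
    Matrix.submatrix_apply]
  rw [Equiv.sum_comp π fun i => sqrtMatrix S (π k) i * e i]

/-- Relabelling the alternatives other than `j` does not change the choice probability of `j`. -/
theorem choiceProb_submatrix {f : (Fin K → ℝ) → ℝ} (hf : IsExchangeableDensity f) {j : Fin K}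
    (v : Fin K → ℝ) {S : Matrix (Fin K) (Fin K) ℝ} (hS : S.PosSemidef) (π : Equiv.Perm (Fin K))
    (hπ : π j = j) :
    choiceProb f j (v ∘ π) (S.submatrix π π) = choiceProb f j v S := by
  let T : (Fin K → ℝ) ≃ᵐ (Fin K → ℝ) := MeasurableEquiv.piCongrLeft (fun _ => ℝ) π.symm
  have hT : ∀ e, T e = e ∘ π := by
    intro e
    ext k
    have h := Equiv.piCongrLeft_apply_apply (fun _ => ℝ) π.symm e (π k)
    rw [Equiv.symm_apply_apply] at h
    exact h
  have hmp : MeasurePreserving T volume volume :=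
    volume_measurePreserving_piCongrLeft (fun _ => ℝ) π.symm
  have hpre : T ⁻¹' choiceRegion j (v ∘ π) (S.submatrix π π) = choiceRegion j v S := by
    ext e
    simp only [choiceRegion, Set.mem_preimage, Set.mem_ofPred_eq, hT, utility_submatrix hS, hπ]
    constructor
    · intro h k hk
      simpa using h (π.symm k) (fun h' => hk (by rw [← π.apply_symm_apply k, h', hπ]))
    · intro h k hk
      exact h (π k) (fun h' => hk (π.injective (h'.trans hπ.symm)))
  unfold choiceProb
  rw [← hmp.setIntegral_preimage_emb T.measurableEmbedding, hpre]
  simp only [hT, hf.exchangeable]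

theorem IsExchangeableDensity.integrable {f : (Fin K → ℝ) → ℝ} (hf : IsExchangeableDensity f) :
    Integrable f := by
  refine ⟨hf.measurable.aestronglyMeasurable, ?_⟩
  rw [hasFiniteIntegral_iff_ofReal (Filter.Eventually.of_forall hf.nonneg), hf.lintegral_eq_one]
  exact ENNReal.one_lt_top

/-- A nontrivial affine hyperplane is Lebesgue null. -/
theorem volume_dotProduct_eq (a : Fin K → ℝ) (c : ℝ) (ha : a ≠ 0) :
    volume {e : Fin K → ℝ | a ⬝ᵥ e = c} = 0 := by
  classical
  let φ : (Fin K → ℝ) →ₗ[ℝ] ℝ := dotProductBilin ℝ ℝ a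
  by_cases hne : ∃ e₀ : Fin K → ℝ, a ⬝ᵥ e₀ = c
  · obtain ⟨e₀, he₀⟩ := hne
    let Q : AffineSubspace ℝ (Fin K → ℝ) := AffineSubspace.mk' e₀ φ.ker
    have hQ : (Q : Set (Fin K → ℝ)) = {e : Fin K → ℝ | a ⬝ᵥ e = c} := by
      ext e
      simp [Q, φ, AffineSubspace.mem_mk', dotProduct_sub, he₀, sub_eq_zero]
    rw [← hQ]
    refine Measure.addHaar_affineSubspace volume Q fun htop => ha ?_
    have hall : ∀ e : Fin K → ℝ, a ⬝ᵥ e = c := fun e => by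
      have : e ∈ (Q : Set (Fin K → ℝ)) := by rw [htop]; trivial
      rwa [hQ] at this
    have h0 : c = 0 := by simpa using (hall 0).symm
    ext i
    simpa [h0] using hall (Pi.single i 1)
  · push Not at hne
    simp [hne]

/-- Off the structural ties, utilities of distinct alternatives tie with probability zero. -/
theorem ae_utility_ne {j : Fin K} {x : (Fin K → ℝ) × Matrix (Fin K) (Fin K) ℝ}
    (hx : x ∈ choiceDomain j) (k : Fin K) (hk : k ≠ j) :
    ∀ᵐ e : Fin K → ℝ, utility x.1 x.2 e k ≠ utility x.1 x.2 e j := by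
  set A := sqrtMatrix x.2 with hA
  have hsym : ∀ i l, A i l = A l i := fun i l => by
    simpa using (sqrtMatrix_posSemidef x.2).1.apply l i
  -- Entries are inner products of rows of the root, so `Y_jj + Y_kk - 2 Y_jk` is the squared
  -- distance between rows `j` and `k`; equal rows without a structural tie force `v_j ≠ v_k`.
  have hY : ∀ i l, x.2 i l = A i ⬝ᵥ A l := fun i l => by
    conv_lhs => rw [← sqrtMatrix_mul_self hx.1]
    rw [Matrix.mul_apply, dotProduct]
    exact Finset.sum_congr rfl fun m _ => by rw [← hA, hsym m l]
  have hset : {e : Fin K → ℝ | ¬ utility x.1 x.2 e k ≠ utility x.1 x.2 e j} =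
      {e : Fin K → ℝ | (A k - A j) ⬝ᵥ e = x.1 j - x.1 k} := by
    ext e
    simp only [ne_eq, not_not, Set.mem_ofPred_eq, utility, Matrix.mulVec, ← hA, sub_dotProduct]
    constructor <;> intro h <;> linarith
  rw [ae_iff, hset]
  by_cases h0 : A k - A j = 0
  · have hrow : A k = A j := sub_eq_zero.1 h0
    have hv : x.1 j - x.1 k ≠ 0 := fun hv => hx.2 k hk
      ⟨by linarith, by rw [hY, hY, hY, hrow]; ring⟩
    simp [h0, hv.symm]
  · exact volume_dotProduct_eq _ _ h0

/-- The choice probability is continuous off the structural ties. -/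
theorem continuousOn_choiceProb {f : (Fin K → ℝ) → ℝ} (hf : IsExchangeableDensity f)
    (j : Fin K) : ContinuousOn (fun x => choiceProb f j x.1 x.2) (choiceDomain j) := by
  have hutil : ∀ e k, ContinuousOn (fun x : (Fin K → ℝ) × Matrix (Fin K) (Fin K) ℝ =>
      utility x.1 x.2 e k) (choiceDomain j) := by
    intro e k
    have h1 : ContinuousOn (fun x : (Fin K → ℝ) × Matrix (Fin K) (Fin K) ℝ => sqrtMatrix x.2)
        (choiceDomain j) := continuousOn_sqrtMatrix.comp continuousOn_snd fun x hx => hx.1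
    have h2 : Continuous fun q : ℝ × Matrix (Fin K) (Fin K) ℝ => q.1 + q.2.mulVec e k := by
      unfold Matrix.mulVec dotProduct
      fun_prop
    have h3 : ContinuousOn (fun x : (Fin K → ℝ) × Matrix (Fin K) (Fin K) ℝ => x.1 k)
        (choiceDomain j) := by fun_prop
    exact h2.comp_continuousOn (h3.prodMk h1)
  have hmeas : ∀ x : (Fin K → ℝ) × Matrix (Fin K) (Fin K) ℝ,
      MeasurableSet (choiceRegion j x.1 x.2) := by
    intro x
    have hu : ∀ k, Measurable fun e => utility x.1 x.2 e k := fun k => by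
      unfold utility Matrix.mulVec dotProduct
      fun_prop
    simp only [choiceRegion, Set.ofPred_forall]
    exact MeasurableSet.iInter fun k => MeasurableSet.iInter fun _ =>
      measurableSet_le (hu k) (hu j)
  have heq : (fun x : (Fin K → ℝ) × Matrix (Fin K) (Fin K) ℝ => choiceProb f j x.1 x.2) =
      fun x => ∫ e, (choiceRegion j x.1 x.2).indicator f e := by
    funext x
    rw [choiceProb, integral_indicator (hmeas x)]
  rw [heq]
  have : FirstCountableTopology (Matrix (Fin K) (Fin K) ℝ) :=
    inferInstanceAs (FirstCountableTopology (Fin K → Fin K → ℝ))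
  intro x hx
  refine tendsto_integral_filter_of_dominated_convergence f ?_ ?_ hf.integrable ?_
  · exact Filter.Eventually.of_forall fun y =>
      (hf.measurable.indicator (hmeas y)).aestronglyMeasurable
  · refine Filter.Eventually.of_forall fun y => Filter.Eventually.of_forall fun e => ?_
    refine (norm_indicator_le_norm_self _ _).trans_eq ?_
    rw [Real.norm_of_nonneg (hf.nonneg e)]
  · have hae : ∀ᵐ e : Fin K → ℝ, ∀ k, k ≠ j → utility x.1 x.2 e k ≠ utility x.1 x.2 e j :=
      ae_all_iff.2 fun k => by
        by_cases hk : k = j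
        · simp [hk]
        · filter_upwards [ae_utility_ne hx k hk] with e he _ using he
    filter_upwards [hae] with e he
    -- For an `e` without ties at `x`, finitely many strict inequalities persist nearby, so the
    -- indicator is locally constant.
    refine tendsto_const_nhds.congr' ?_
    have hev : ∀ k, ∀ᶠ y in 𝓝[choiceDomain j] x, k ≠ j →
        (utility y.1 y.2 e k ≤ utility y.1 y.2 e j ↔
          utility x.1 x.2 e k ≤ utility x.1 x.2 e j) := by
      intro k
      by_cases hk : k = j
      · simp [hk]
      rcases lt_or_gt_of_ne (he k hk) with hlt | hlt
      · filter_upwards [(hutil e k x hx).eventually_lt (hutil e j x hx) hlt] with y hy _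
        exact iff_of_true hy.le hlt.le
      · filter_upwards [(hutil e j x hx).eventually_lt (hutil e k x hx) hlt] with y hy _
        exact iff_of_false hy.not_ge hlt.not_ge
    filter_upwards [Filter.eventually_all.2 hev] with y hy
    have hiff : e ∈ choiceRegion j y.1 y.2 ↔ e ∈ choiceRegion j x.1 x.2 :=
      forall_congr' fun k => ⟨fun h hk => (hy k hk).1 (h hk), fun h hk => (hy k hk).2 (h hk)⟩
    by_cases hmem : e ∈ choiceRegion j x.1 x.2
    · rw [Set.indicator_of_mem hmem, Set.indicator_of_mem (hiff.2 hmem)]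
    · rw [Set.indicator_of_notMem hmem, Set.indicator_of_notMem (mt hiff.1 hmem)]

end DiscreteChoice

/-! ### Recovering a point from its features -/

namespace DiscreteChoice

variable {K : ℕ}

/-- Two injective families on a finite set with the same multiset of values differ by a
permutation of that set. -/
theorem exists_perm_of_map_eq {α β : Type*} [DecidableEq α] {s : Finset α} {g h : α → β}
    (hh : Set.InjOn h s) (hgh : s.val.map g = s.val.map h) :
    ∃ p : Equiv.Perm α, (∀ a ∈ s, p a ∈ s) ∧ (∀ a ∈ s, h a = g (p a)) ∧ ∀ a ∉ s, p a = a := by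
  have hex : ∀ a : s, ∃ b : s, g b = h a := by
    intro a
    have : h a ∈ s.val.map g := by
      rw [hgh]
      exact Multiset.mem_map_of_mem h a.2
    obtain ⟨b, hb, hba⟩ := Multiset.mem_map.1 this
    exact ⟨⟨b, hb⟩, hba⟩
  choose b hb using hex
  have hinj : Function.Injective b := fun a a' haa =>
    Subtype.ext (hh a.2 a'.2 (by rw [← hb, ← hb, haa]))
  let q : Equiv.Perm {a // a ∈ s} := Equiv.ofBijective b (Finite.injective_iff_bijective.1 hinj)
  refine ⟨Equiv.Perm.ofSubtype q, fun a ha => ?_, fun a ha => ?_, fun a ha => ?_⟩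
  · rw [Equiv.Perm.ofSubtype_apply_of_mem q ha]
    exact (q ⟨a, ha⟩).2
  · rw [Equiv.Perm.ofSubtype_apply_of_mem q ha]
    exact (hb ⟨a, ha⟩).symm
  · exact Equiv.Perm.ofSubtype_apply_of_not_mem q ha

/-- The position above the diagonal in rows and columns `k`, `l`. -/
def position (k l : Fin K) : Fin K × Fin K := (min k l, max k l)

theorem apply_position {Y : Matrix (Fin K) (Fin K) ℝ} (hY : Y.IsSymm) (k l : Fin K) :
    Y (position k l).1 (position k l).2 = Y k l := by
  rcases le_total k l with h | h
  · simp [position, h]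
  · simp [position, h, hY.apply]

/-- The off-diagonal positions away from `j` that involve `k`. -/
def star (j k : Fin K) : Finset (Fin K × Fin K) :=
  ((Finset.univ.erase j).erase k).image (position k)

theorem position_injOn (j k : Fin K) :
    Set.InjOn (position k) ((Finset.univ.erase j).erase k : Finset (Fin K)) := by
  intro a ha b hb hab
  simp only [position, Prod.mk.injEq] at hab
  simp only [Finset.coe_erase, Set.mem_sdiff, Set.mem_singleton_iff] at ha hb
  grind

theorem position_mem_star {j k l : Fin K} (hl : l ≠ j) (hkl : k ≠ l) :
    position k l ∈ star j k :=
  Finset.mem_image_of_mem _ (by simp [hl, hkl.symm])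

theorem position_comm (k l : Fin K) : position k l = position l k := by
  simp [position, min_comm, max_comm]

/-- Positions are edges of the complete graph on the other alternatives; two distinct vertices share
only the edge joining them. -/
theorem eq_position_of_mem_star {j k l : Fin K} (hkl : k ≠ l) {p : Fin K × Fin K}
    (hk : p ∈ star j k) (hl : p ∈ star j l) : p = position k l := by
  obtain ⟨a, ha, rfl⟩ := Finset.mem_image.1 hk
  obtain ⟨b, hb, hab⟩ := Finset.mem_image.1 hl
  simp only [Finset.mem_erase] at ha hb
  simp only [position, Prod.mk.injEq] at hab ⊢
  grind

theorem star_subset {j k : Fin K} (hk : k ≠ j) : star j k ⊆ offPositions j := by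
  intro p hp
  obtain ⟨a, ha, rfl⟩ := Finset.mem_image.1 hp
  simp only [Finset.mem_erase] at ha
  simp only [offPositions, Finset.mem_filter, Finset.mem_univ, true_and, position]
  grind

theorem card_star {j k : Fin K} (hk : k ≠ j) : (star j k).card = K - 2 := by
  rw [star, Finset.card_image_of_injOn (position_injOn j k), Finset.card_erase_of_mem (by simp [hk]),
    Finset.card_erase_of_mem (by simp), Finset.card_univ, Fintype.card_fin]
  omega

/-- Row `k` of `Y` sums to zero; removing its entries in columns `j` and `k` leaves the star. -/
theorem sum_star {j k : Fin K} (hk : k ≠ j) {x : (Fin K → ℝ) × Matrix (Fin K) (Fin K) ℝ}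
    (hx : x ∈ centeredSpace K) : ∑ p ∈ star j k, x.2 p.1 p.2 = -x.2 k k - x.2 j k := by
  rw [star, Finset.sum_image (position_injOn j k)]
  simp only [apply_position hx.1]
  have hrow : ∑ l, x.2 k l = 0 := by
    have := congrFun hx.2.2.1 k
    simpa [Matrix.mulVec, dotProduct] using this
  rw [← Finset.add_sum_erase _ _ (Finset.mem_univ j),
    ← Finset.add_sum_erase _ _ (Finset.mem_erase.2 ⟨hk, Finset.mem_univ k⟩)] at hrow
  rw [← hx.1.apply j k]
  linarith

/-- If two families have the same sum and agree up to a permutation away from `j`, they agree at `j`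
as well. -/
theorem apply_eq_of_sum_eq {M : Type*} [AddCommGroup M] (j : Fin K) {a b : Fin K → M}
    (h : ∑ i, a i = ∑ i, b i) (π : Equiv.Perm (Fin K))
    (hab : ∀ k, k ≠ j → b k = a (π k)) : b j = a (π j) := by
  rw [← Equiv.sum_comp π a, ← Finset.add_sum_erase _ _ (Finset.mem_univ j),
    ← Finset.add_sum_erase _ b (Finset.mem_univ j)] at h
  rw [Finset.sum_congr rfl fun k hk => (hab k (Finset.ne_of_mem_erase hk))] at h
  exact (add_right_cancel h).symm

/-- Off the exceptional set, the multisets of triples and of off-diagonal entries determine the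
point up to a relabelling of the alternatives other than `j`. -/
theorem exists_perm_of_multisets_eq {j : Fin K} {x y : (Fin K → ℝ) × Matrix (Fin K) (Fin K) ℝ}
    (hx : x ∈ centeredSpace K \ exceptionalSet j) (hy : y ∈ centeredSpace K \ exceptionalSet j)
    (ht : tripleMultiset j x = tripleMultiset j y) (ho : offMultiset j x = offMultiset j y) :
    ∃ π : Equiv.Perm (Fin K), π j = j ∧ y.1 = x.1 ∘ π ∧ y.2 = x.2.submatrix π π := by
  obtain ⟨hxc, hxe⟩ := hx
  obtain ⟨hyc, hye⟩ := hy
  have hxg : ∀ k, k ≠ j → ∃! T : Finset (Fin K × Fin K), T ⊆ offPositions j ∧ T.card = K - 2 ∧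
      ∑ p ∈ T, x.2 p.1 p.2 = -x.2 k k - x.2 j k := by
    by_contra h
    exact hxe ⟨hxc, fun h' => h h'.2⟩
  have hyg : Set.InjOn (triple j y) (others j) ∧
      Set.InjOn (fun p : Fin K × Fin K => y.2 p.1 p.2) (offPositions j) := by
    by_contra h
    exact hye ⟨hyc, fun h' => h h'.1⟩
  obtain ⟨π, hπs, hπ, hπj⟩ := exists_perm_of_map_eq hyg.1 ht
  obtain ⟨ρ, hρs, hρ, -⟩ := exists_perm_of_map_eq hyg.2 ho
  have hmem : ∀ k, k ∈ others j ↔ k ≠ j := by simp [others]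
  have hjj : π j = j := hπj j (by simp [others])
  have hne : ∀ k, k ≠ j → π k ≠ j := fun k hk => (hmem _).1 (hπs k ((hmem k).2 hk))
  have htr : ∀ k, k ≠ j → y.1 k = x.1 (π k) ∧ y.2 k k = x.2 (π k) (π k) ∧
      y.2 j k = x.2 j (π k) := by
    intro k hk
    have h := hπ k ((hmem k).2 hk)
    simp only [triple, EmbeddingLike.apply_eq_iff_eq, Prod.mk.injEq] at h
    exact h
  have hv : ∀ k, y.1 k = x.1 (π k) := by
    intro k
    by_cases hk : k = j
    · rw [hk]
      exact apply_eq_of_sum_eq j (hxc.2.1.trans hyc.2.1.symm) π fun k hk => (htr k hk).1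
    · exact (htr k hk).1
  have hdiag : ∀ k, y.2 k k = x.2 (π k) (π k) := by
    intro k
    by_cases hk : k = j
    · rw [hk]
      exact apply_eq_of_sum_eq (a := fun i => x.2 i i) (b := fun i => y.2 i i) j
        (hxc.2.2.2.trans hyc.2.2.2.symm) π fun k hk => (htr k hk).2.1
    · exact (htr k hk).2.1
  -- The image has the size and sum that single out the star of `π k`, so the uniqueness condition
  -- at `x` identifies them. This ties the unrelated matchings `ρ` and `π` together.
  have hstar : ∀ k, k ≠ j → (star j k).image ρ = star j (π k) := by
    intro k hk
    refine (hxg (π k) (hne k hk)).unique ⟨?_, ?_, ?_⟩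
      ⟨star_subset (hne k hk), card_star (hne k hk), sum_star (hne k hk) hxc⟩
    · intro p hp
      obtain ⟨q, hq, rfl⟩ := Finset.mem_image.1 hp
      exact hρs q (star_subset hk hq)
    · rw [Finset.card_image_of_injective _ ρ.injective, card_star hk]
    · rw [Finset.sum_image ρ.injective.injOn, ← (htr k hk).2.1, ← (htr k hk).2.2,
        ← sum_star hk hyc]
      exact Finset.sum_congr rfl fun p hp => (hρ p (star_subset hk hp)).symm
  refine ⟨π, hjj, funext hv, ?_⟩
  ext k l
  rw [Matrix.submatrix_apply]
  by_cases hkl : k = l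
  · rw [hkl, hdiag]
  by_cases hk : k = j
  · rw [hk, hjj, (htr l (fun h => hkl (hk.trans h.symm))).2.2]
  by_cases hl : l = j
  · rw [hl, hjj, hyc.1.apply j k, (htr k hk).2.2, hxc.1.apply j (π k)]
  have hp : ρ (position k l) = position (π k) (π l) := by
    refine eq_position_of_mem_star (j := j) (fun h => hkl (π.injective h)) ?_ ?_
    · rw [← hstar k hk]
      exact Finset.mem_image_of_mem _ (position_mem_star hl hkl)
    · rw [← hstar l hl, position_comm]
      exact Finset.mem_image_of_mem _ (position_mem_star hk (Ne.symm hkl))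
  have h := hρ (position k l) (star_subset hk (position_mem_star hl hkl))
  simp only [hp] at h
  rwa [apply_position hyc.1, apply_position hxc.1] at h

/-! ### Sorting, enumerations and factorization -/

/-- The values of `g` on a finite set, in increasing order, are the values of `g` along an
enumeration of the set. -/
theorem exists_enumeration_sort {α β : Type*} [LinearOrder β] (s : Finset α) (g : α → β) :
    ∃ τ : Fin s.card → α, Finset.univ.val.map τ = s.val ∧
      (s.val.map g).sort (· ≤ ·) = List.ofFn fun i => g (τ i) := by
  let e : Fin s.card → α := fun i => (s.equivFin.symm i).1
  have he : Finset.univ.val.map e = s.val := by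
    have h1 : (Finset.univ.val : Multiset (Fin s.card)).map s.equivFin.symm =
        (Finset.univ : Finset s).val := by
      simp
    have h2 : (Finset.univ : Finset s).val.map (fun a => a.1) = s.val := by
      exact Multiset.attach_map_val s.val
    rw [← h2, ← h1, Multiset.map_map]
    rfl
  let π := Tuple.sort (g ∘ e)
  have hτ : Finset.univ.val.map (e ∘ π) = s.val := by
    have h1 : (Finset.univ.val : Multiset (Fin s.card)).map π = Finset.univ.val := by
      simp
    rw [← Multiset.map_map, h1, he]
  refine ⟨e ∘ π, hτ, ?_⟩
  have hmono : Monotone fun i => g ((e ∘ π) i) := Tuple.monotone_sort (g ∘ e)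
  refine List.Perm.eq_of_pairwise' (Multiset.pairwise_sort _ _) ?_ ?_
  · exact hmono.sortedLE_ofFn.pairwise
  · rw [← Multiset.coe_eq_coe, Multiset.sort_eq, ← hτ, Multiset.map_map, ← Fin.univ_val_map]
    rfl

/-- The components of `g_j`, listed along given enumerations of the alternatives other than `j` and
of the off-diagonal positions. -/
def enumeratedFeatures (j : Fin K) (τ : Fin (others j).card → Fin K)
    (ρ : Fin (offPositions j).card → Fin K × Fin K)
    (x : (Fin K → ℝ) × Matrix (Fin K) (Fin K) ℝ) : FeatureIndex j → ℝ
  | Sum.inl (i, c) => ![x.1 (τ i), x.2 (τ i) (τ i), x.2 j (τ i)] c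
  | Sum.inr i => x.2 (ρ i).1 (ρ i).2

/-- Pairs of enumerations of the alternatives other than `j` and of the off-diagonal positions. -/
abbrev Enumeration (j : Fin K) : Type :=
  {q : (Fin (others j).card → Fin K) × (Fin (offPositions j).card → Fin K × Fin K) //
    Finset.univ.val.map q.1 = (others j).val ∧ Finset.univ.val.map q.2 = (offPositions j).val}

/-- The enumeration depends on `x`, but only finitely many exist and each gives a continuous map. -/
theorem exists_features_eq (j : Fin K) (x : (Fin K → ℝ) × Matrix (Fin K) (Fin K) ℝ) :
    ∃ q : Enumeration j, features j x = enumeratedFeatures j q.1.1 q.1.2 x := by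
  obtain ⟨τ, hτ, hτs⟩ := exists_enumeration_sort (others j) (triple j x)
  obtain ⟨ρ, hρ, hρs⟩ := exists_enumeration_sort (offPositions j)
    fun p : Fin K × Fin K => x.2 p.1 p.2
  refine ⟨⟨(τ, ρ), hτ, hρ⟩, ?_⟩
  funext a
  rcases a with ⟨i, c⟩ | i
  · have h : sortedTriple j x i = triple j x (τ i) := by
      simp only [sortedTriple, tripleMultiset, hτs, List.getElem_ofFn]
    simp only [features, enumeratedFeatures, h]
    rfl
  · simp only [features, enumeratedFeatures, sortedOff, offMultiset, hρs, List.getElem_ofFn]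

/-- Multisets forget the enumeration, so coincidences between different enumerations are harmless.
-/
theorem multisets_eq_of_enumeratedFeatures_eq {j : Fin K} (q r : Enumeration j)
    {x y : (Fin K → ℝ) × Matrix (Fin K) (Fin K) ℝ}
    (h : enumeratedFeatures j q.1.1 q.1.2 x = enumeratedFeatures j r.1.1 r.1.2 y) :
    tripleMultiset j x = tripleMultiset j y ∧ offMultiset j x = offMultiset j y := by
  constructor
  · rw [tripleMultiset, tripleMultiset]
    conv_lhs => rw [← q.2.1]
    conv_rhs => rw [← r.2.1]
    rw [Multiset.map_map, Multiset.map_map]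
    refine Multiset.map_congr rfl fun i _ => ?_
    have h0 := congrFun h (Sum.inl (i, 0))
    have h1 := congrFun h (Sum.inl (i, 1))
    have h2 := congrFun h (Sum.inl (i, 2))
    simp only [enumeratedFeatures, Matrix.cons_val] at h0 h1 h2
    simp only [Function.comp_apply, triple, h0, h1, h2]
  · rw [offMultiset, offMultiset]
    conv_lhs => rw [← q.2.2]
    conv_rhs => rw [← r.2.2]
    rw [Multiset.map_map, Multiset.map_map]
    exact Multiset.map_congr rfl fun i _ => congrFun h (Sum.inr i)

theorem continuous_enumeratedFeatures (j : Fin K) (τ : Fin (others j).card → Fin K)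
    (ρ : Fin (offPositions j).card → Fin K × Fin K) :
    Continuous (enumeratedFeatures j τ ρ) := by
  refine continuous_pi fun a => ?_
  rcases a with ⟨i, c⟩ | i
  · fin_cases c <;> simp only [enumeratedFeatures] <;> simp <;> fun_prop
  · simp only [enumeratedFeatures]
    fun_prop

/-- A continuous function on a compact space that is constant on the fibers of a continuous map to
a Hausdorff space factors continuously through the range of that map. -/
theorem exists_continuous_factor {X Y : Type*} [TopologicalSpace X] [CompactSpace X]
    [TopologicalSpace Y] [T2Space Y] {F : X → Y} (hF : Continuous F) {P : X → ℝ}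
    (hP : Continuous P) (hfib : ∀ a b, F a = F b → P a = P b) :
    ∃ Φ : C(Set.range F, ℝ), ∀ a, Φ ⟨F a, a, rfl⟩ = P a := by
  have hc : Continuous (Set.rangeFactorization F) := hF.subtype_mk _
  -- A continuous surjection from a compact space onto a Hausdorff space is a quotient map.
  have hquot : Topology.IsQuotientMap (Set.rangeFactorization F) :=
    Topology.IsQuotientMap.of_surjective_continuous Set.rangeFactorization_surjective hc
  let Φ : Set.range F → ℝ := fun y => P y.2.choose
  have hΦ : ∀ a, Φ (Set.rangeFactorization F a) = P a := fun a =>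
    hfib _ _ (Set.rangeFactorization F a).2.choose_spec
  refine ⟨⟨Φ, hquot.continuous_iff.2 ?_⟩, hΦ⟩
  exact hP.congr fun a => (hΦ a).symm

end DiscreteChoice

/-! ### Assembly -/

theorem theorem2 {K : ℕ} (f : (Fin K → ℝ) → ℝ) (hf : DiscreteChoice.IsExchangeableDensity f)
    (σ : ℝ → ℝ) (hσ : Continuous σ) (hσp : ¬ ∃ p : Polynomial ℝ, ∀ t, σ t = p.eval t)
    (j : Fin K) (C : Set ((Fin K → ℝ) × Matrix (Fin K) (Fin K) ℝ)) (hC : IsCompact C)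
    (hCX : C ⊆ DiscreteChoice.centeredSpace K \ DiscreteChoice.exceptionalSet j)
    (hCdom : C ⊆ DiscreteChoice.choiceDomain j) (ε : ℝ) (hε : 0 < ε) :
    ∃ N : DiscreteChoice.MLP (DiscreteChoice.FeatureIndex j), ∀ x ∈ C,
      |N.eval σ (DiscreteChoice.features j x) - DiscreteChoice.choiceProb f j x.1 x.2| < ε := by
  open DiscreteChoice in
  have : CompactSpace C := isCompact_iff_compactSpace.1 hC
  -- The finite discrete factor keeps the domain compact and makes every sorted feature vector over
  -- `C` a value of `F`.
  let F : Enumeration j × C → FeatureIndex j → ℝ :=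
    fun a => enumeratedFeatures j a.1.1.1 a.1.1.2 a.2
  have hF : Continuous F := continuous_prod_of_discrete_left.2 fun q =>
    (continuous_enumeratedFeatures j q.1.1 q.1.2).comp continuous_subtype_val
  have hP : Continuous fun a : Enumeration j × C => choiceProb f j a.2.1.1 a.2.1.2 :=
    (((continuousOn_choiceProb hf j).mono hCdom).domRestrict).comp continuous_snd
  have hfib : ∀ a b : Enumeration j × C, F a = F b →
      choiceProb f j a.2.1.1 a.2.1.2 = choiceProb f j b.2.1.1 b.2.1.2 := by
    intro a b hab
    obtain ⟨ht, ho⟩ := multisets_eq_of_enumeratedFeatures_eq a.1 b.1 hab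
    obtain ⟨π, hπ, hv, hY⟩ := exists_perm_of_multisets_eq (hCX a.2.2) (hCX b.2.2) ht ho
    rw [hv, hY, choiceProb_submatrix hf _ (hCdom a.2.2).1 π hπ]
  obtain ⟨Φ, hΦ⟩ := exists_continuous_factor hF hP hfib
  have : CompactSpace (Set.range F) := isCompact_iff_compactSpace.1 (isCompact_range hF)
  obtain ⟨N, hN⟩ := exists_shallow_approx (X := Set.range F) ⟨Subtype.val, continuous_subtype_val⟩
    Subtype.val_injective σ hσ hσp Φ ε hε
  refine ⟨N, fun x hx => ?_⟩
  obtain ⟨q, hq⟩ := exists_features_eq j x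
  have h := hN ⟨F (q, ⟨x, hx⟩), _, rfl⟩
  rw [hΦ] at h
  rw [hq]
  exact h
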